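/- All spaces are over $\mathbb C$. Write $\langle\cdot,\cdot\rangle$ for the pairing of a Banach space $X$ with its dual $X'$. A dual Banach algebra $(A,A_*)$ is a Banach algebra $A$ (with $\|ab\|\le\|a\|\|b\|$, and $\|1\|=1$ if $A$ is unital) together with a Banach space $A_*$ and an isometric identification $A=(A_*)'$ for which the product of $A$ is separately weak$^*$-continuous. A Banach left $A$-module is a Banach space $E$ with a bilinear action $(a,x)\mapsto a\cdot x$ such that $(ab)\cdot x=a\cdot(b\cdot x)$ and $\|a\cdot x\|\le\|a\|\|x\|$; for $\mu\in E'$ and $a\in A$, $\mu\cdot a\in E'$ is given by $\langle\mu\cdot a,x\rangle=\langle\mu,a\cdot x\rangle$. A reflexive $E$ is normal if, for every $x\in E$, the map $a\mapsto a\cdot x$ is $\sigma(A,A_*)$-$\sigma(E,E')$ continuous. The Banach space $\mathcal B(A,A')$ of bounded linear maps $A\to A'$ is a Banach $A$-bimodule with $(c\cdot T)(b)(a)=T(bc)(a)$ and $(T\cdot c)(b)(a)=T(b)(ca)$ (this is the bimodule dual to $A\widehat\otimes A$ under $\langle T,a\otimes b\rangle=T(b)(a)$). For a Banach $A$-bimodule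 $X$, $\sigma WC(X)$ is the set of $x\in X$ such that both maps $a\mapsto a\cdot x$ and $a\mapsto x\cdot a$ are $\sigma(A,A_*)$-$\sigma(X,X')$ continuous. **Theorem.** There is an absolute constant $K>0$ such that the following holds. Let $(A,A_*)$ be a unital dual Banach algebra and let $T\in\mathcal B(A,A')$. Then the following are equivalent: 1. $T\in\sigma WC(\mathcal B(A,A'))$; 2. there exist a normal reflexive Banach left $A$-module $E$, $x\in E$, $\mu\in E'$ and $S\in\mathcal B(E)$ such that $T(b)(a)=\langle\mu\cdot a,\,S(b\cdot x)\rangle$ for all $a,b\in A$. Moreover, in this case, $E$, $x$, $\mu$ and $S$ in (2) may be chosen such that in addition $\|x\|\,\|\mu\|\,\|S\|\le K\|T\|$. -/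

import Mathlib

open scoped Topology

universe u v

/-- The weak topology `σ(X, X')` of a normed space, as a topology on `X` itself. -/
@[reducible] noncomputable def weakTopology (X : Type*) [NormedAddCommGroup X] [NormedSpace ℂ X] : TopologicalSpace X :=
  TopologicalSpace.induced (fun x : X => toWeakSpace ℂ X x) inferInstance

/-- The weak-star topology `σ(A, P)` on a normed space `A` which is identified with the dual of
`P` by `e`. -/
@[reducible] noncomputable def weakStarTopology {A P : Type*} [NormedAddCommGroup A] [NormedSpace ℂ A]
    [NormedAddCommGroup P] [NormedSpace ℂ P] (e : A ≃ₗᵢ[ℂ] StrongDual ℂ P) :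
    TopologicalSpace A :=
  TopologicalSpace.induced (fun a : A => StrongDual.toWeakDual (e a)) inferInstance

/-- A Banach space is reflexive if its canonical embedding in the bidual is onto. -/
def IsReflexiveSpace (E : Type*) [NormedAddCommGroup E] [NormedSpace ℂ E] : Prop :=
  Function.Surjective (NormedSpace.inclusionInDoubleDual ℂ E)

/-- The structure of a dual Banach algebra with predual `P` on a Banach algebra `A`: an isometric
identification of `A` with the dual of `P` for which the product of `A` is separately weak-star
continuous. -/
structure DualBanachAlgebra (A P : Type*) [NormedRing A] [NormedAlgebra ℂ A]
    [NormedAddCommGroup P] [NormedSpace ℂ P] where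
  toDual : A ≃ₗᵢ[ℂ] StrongDual ℂ P
  continuous_mul_left : ∀ a : A,
    Continuous[weakStarTopology toDual, weakStarTopology toDual] (fun b : A => a * b)
  continuous_mul_right : ∀ a : A,
    Continuous[weakStarTopology toDual, weakStarTopology toDual] (fun b : A => b * a)

/-- A (contractive) Banach left `A`-module structure on `E`; `lact a x` is `a · x`. -/
structure BanachLeftModule (A E : Type*) [NormedRing A] [NormedAlgebra ℂ A]
    [NormedAddCommGroup E] [NormedSpace ℂ E] where
  lact : A →ₗ[ℂ] E →L[ℂ] E
  lact_mul : ∀ (a b : A) (x : E), lact (a * b) x = lact a (lact b x)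
  norm_lact_le : ∀ (a : A) (x : E), ‖lact a x‖ ≤ ‖a‖ * ‖x‖

/-- A (contractive) Banach `A`-bimodule structure on `E`; `lact a x` is `a · x` and `ract a x` is
`x · a`. -/
structure BanachBimodule (A E : Type*) [NormedRing A] [NormedAlgebra ℂ A]
    [NormedAddCommGroup E] [NormedSpace ℂ E] extends BanachLeftModule A E where
  ract : A →ₗ[ℂ] E →L[ℂ] E
  ract_mul : ∀ (a b : A) (x : E), ract (a * b) x = ract b (ract a x)
  norm_ract_le : ∀ (a : A) (x : E), ‖ract a x‖ ≤ ‖a‖ * ‖x‖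
  lact_ract : ∀ (a b : A) (x : E), lact a (ract b x) = ract b (lact a x)

namespace BanachLeftModule

variable {A E : Type*} [NormedRing A] [NormedAlgebra ℂ A] [NormedAddCommGroup E] [NormedSpace ℂ E]

/-- The right action of `A` on the dual of a left `A`-module: `⟨μ · a, x⟩ = ⟨μ, a · x⟩`. -/
noncomputable def dualRact (M : BanachLeftModule A E) (μ : StrongDual ℂ E) (a : A) : StrongDual ℂ E :=
  μ.comp (M.lact a)

/-- A left module over a dual Banach algebra is normal if `a ↦ a · x` is continuous from the
weak-star topology of `A` to the weak topology of `E`, for each `x`.  (It is only used for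
reflexive `E`, where the weak topology is the weak-star topology of `E = (E')'`.) -/
def IsNormal {P : Type*} [NormedAddCommGroup P] [NormedSpace ℂ P]
    (M : BanachLeftModule A E) (D : DualBanachAlgebra A P) : Prop :=
  ∀ x : E, Continuous[weakStarTopology D.toDual, weakTopology E] (fun a : A => M.lact a x)

end BanachLeftModule

/-- `σWC(E)` for a Banach bimodule `E` over a dual Banach algebra `A` with predual `P`: those `x`
for which both `a ↦ a · x` and `a ↦ x · a` are `σ(A, P)`-`σ(E, E')` continuous. -/
def sigmaWC {A P E : Type*} [NormedRing A] [NormedAlgebra ℂ A]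
    [NormedAddCommGroup P] [NormedSpace ℂ P] [NormedAddCommGroup E] [NormedSpace ℂ E]
    (D : DualBanachAlgebra A P) (M : BanachBimodule A E) : Set E :=
  {x | Continuous[weakStarTopology D.toDual, weakTopology E] (fun a : A => M.lact a x) ∧
       Continuous[weakStarTopology D.toDual, weakTopology E] (fun a : A => M.ract a x)}

/-- The canonical Banach `A`-bimodule structure on `B(A, A')`.  It is the dual of the usual
bimodule structure `c · (a ⊗ b) = ca ⊗ b`, `(a ⊗ b) · c = a ⊗ bc` of the projective tensor square
of `A`, through the duality `⟨T, a ⊗ b⟩ = T b a`: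
`⟨c · T, a ⊗ b⟩ = ⟨T, a ⊗ bc⟩` and `⟨T · c, a ⊗ b⟩ = ⟨T, ca ⊗ b⟩`. -/
noncomputable def operatorBimodule (A : Type*) [NormedRing A] [NormedAlgebra ℂ A] :
    BanachBimodule A (A →L[ℂ] StrongDual ℂ A) where
  lact :=
    { toFun := fun c => (ContinuousLinearMap.compL ℂ A A (StrongDual ℂ A)).flip
        ((ContinuousLinearMap.mul ℂ A).flip c)
      map_add' := fun c d => by ext T b a; simp
      map_smul' := fun z c => by ext T b a; simp }
  ract :=
    { toFun := fun c => ContinuousLinearMap.compL ℂ A (StrongDual ℂ A) (StrongDual ℂ A)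
        ((ContinuousLinearMap.compL ℂ A A ℂ).flip (ContinuousLinearMap.mul ℂ A c))
      map_add' := fun c d => by ext T b a; simp
      map_smul' := fun z c => by ext T b a; simp }
  lact_mul := fun c d T => by ext b a; simp [mul_assoc]
  ract_mul := fun c d T => by ext b a; simp [mul_assoc]
  lact_ract := fun c d T => by ext b a; simp
  norm_lact_le := fun c T => by
    refine ContinuousLinearMap.opNorm_le_bound _ (by positivity) fun b => ?_
    calc ‖T (b * c)‖ ≤ ‖T‖ * (‖b‖ * ‖c‖) := T.le_opNorm_of_le (norm_mul_le b c)
      _ = ‖c‖ * ‖T‖ * ‖b‖ := by ring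
  norm_ract_le := fun c T => by
    refine ContinuousLinearMap.opNorm_le_bound _ (by positivity) fun b => ?_
    refine ContinuousLinearMap.opNorm_le_bound _ (by positivity) fun a => ?_
    calc ‖T b (c * a)‖ ≤ ‖T‖ * ‖b‖ * (‖c‖ * ‖a‖) :=
          (T b).le_of_opNorm_le_of_le (T.le_opNorm b) (norm_mul_le c a)
      _ = ‖c‖ * ‖T‖ * ‖b‖ * ‖a‖ := by ring

theorem operatorBimodule_lact_apply {A : Type*} [NormedRing A] [NormedAlgebra ℂ A]
    (T : A →L[ℂ] StrongDual ℂ A) (a b c : A) :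
    (operatorBimodule A).lact c T b a = T (b * c) a := rfl

theorem operatorBimodule_ract_apply {A : Type*} [NormedRing A] [NormedAlgebra ℂ A]
    (T : A →L[ℂ] StrongDual ℂ A) (a b c : A) :
    (operatorBimodule A).ract c T b a = T b (c * a) := rfl

/-! If (2) holds, `c · T` is the image of `c · x` under a bounded map from `E`, and `T · c` the
image of `μ · c` under a bounded map from `E'`; normality, together with reflexivity for the second
orbit, gives (1).

Conversely, let `L c = c · T` and `M c = T · c`. Both maps are weak-star to weak continuous, hence
weakly compact, and Davis–Figiel–Johnson–Pełczyński interpolation between `A` and `B(A, A')` yields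
spaces `InterpSpace L` and `InterpSpace M` in which `A` maps densely. They are reflexive
(`isReflexiveSpace_interpSpace`), their functionals restrict to elements of the predual on `A`
(`exists_predual_toInterp`), and multiplication in `A` extends to a left action on the one and a
right action on the other (`exists_interp_action`).

Evaluating at the unit bounds the form `T b a` by `‖L b‖ ‖a‖` and by `‖b‖ ‖M a‖`. Bilinear
interpolation (`norm_bilinear_le_interp`) then bounds it by the two interpolation norms, so it
becomes an operator `β` from `InterpSpace L` to the dual of `InterpSpace M`. The direct sum of these
two reflexive left modules is `E`; `S` is `β` between the summands, `x` is the image of `1` in the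
first, and `μ` is evaluation at the image of `1` on the second. -/

/-! ### Truncations of `ℓ²`-sums and reflexivity of their closed subspaces. -/

section Trunc

variable {ι : Type*} {Y : ι → Type*} [∀ i, NormedAddCommGroup (Y i)] [∀ i, NormedSpace ℂ (Y i)]

/-- The projection of `lp Y 2` onto the coordinates in a finite set. -/
noncomputable def lpTrunc [DecidableEq ι] (s : Finset ι) : lp Y 2 →L[ℂ] lp Y 2 :=
  ∑ i ∈ s, (lp.singleContinuousLinearMap ℂ Y 2 i).comp (lp.evalCLM ℂ Y 2 i)

variable [DecidableEq ι]

theorem lpTrunc_apply (s : Finset ι) (x : lp Y 2) : lpTrunc s x = ∑ i ∈ s, lp.single 2 i (x i) := by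
  simp only [lpTrunc, _root_.sum_apply]
  rfl

omit [∀ i, NormedSpace ℂ (Y i)] in
theorem norm_sq_sum_single (s : Finset ι) (x : ∀ i, Y i) :
    ‖∑ i ∈ s, lp.single (E := Y) 2 i (x i)‖ ^ 2 = ∑ i ∈ s, ‖x i‖ ^ 2 := by
  have := lp.norm_sum_single (E := Y) (p := 2) (by norm_num) x s
  simpa using this

theorem norm_sq_lpTrunc_add (s : Finset ι) (x : lp Y 2) :
    ‖lpTrunc s x‖ ^ 2 + ‖x - lpTrunc s x‖ ^ 2 = ‖x‖ ^ 2 := by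
  have h := lp.norm_compl_sum_single (E := Y) (p := 2) (by norm_num) x s
  rw [lpTrunc_apply, norm_sq_sum_single]
  norm_num at h
  rw [h]; ring

theorem norm_lpTrunc_le (s : Finset ι) : ‖lpTrunc (Y := Y) s‖ ≤ 1 := by
  refine ContinuousLinearMap.opNorm_le_bound _ zero_le_one fun x => ?_
  have := norm_sq_lpTrunc_add s x
  rw [one_mul]
  refine le_of_sq_le_sq ?_ (norm_nonneg _)
  nlinarith [sq_nonneg ‖x - lpTrunc s x‖]

theorem lpTrunc_tendsto (x : lp Y 2) :
    Filter.Tendsto (fun s => lpTrunc s x) Filter.atTop (𝓝 x) := by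
  simp only [lpTrunc_apply]
  exact lp.hasSum_single (by norm_num) x

theorem lpTrunc_idem (s : Finset ι) (x : lp Y 2) : lpTrunc s (lpTrunc s x) = lpTrunc s x := by
  rw [lpTrunc_apply s (lpTrunc s x), lpTrunc_apply]
  refine Finset.sum_congr rfl fun i hi => ?_
  congr 1
  rw [lp.coeFn_sum, Finset.sum_apply, Finset.sum_eq_single i]
  · simp
  · intro j _ hj
    simp [lp.single_apply, hj.symm]
  · exact fun h => (h hi).elim

/-- Vectors supported on `s` and off `s` are orthogonal in the `ℓ²` sense. Rotating the two values
of `f` by unimodular scalars makes them add up to the value of `f` at one vector. -/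
theorem norm_lpTrunc_add_norm_le (f : StrongDual ℂ (lp Y 2)) (s : Finset ι) (x y : lp Y 2) :
    ‖f (lpTrunc s x)‖ + ‖f (y - lpTrunc s y)‖ ≤ ‖f‖ * √(‖x‖ ^ 2 + ‖y‖ ^ 2) := by
  obtain ⟨c, hc, hc'⟩ := RCLike.exists_norm_eq_mul_self (f (lpTrunc s x))
  obtain ⟨d, hd, hd'⟩ := RCLike.exists_norm_eq_mul_self (f (y - lpTrunc s y))
  set z := c • lpTrunc s x + d • (y - lpTrunc s y) with hz
  have h1 : lpTrunc s z = c • lpTrunc s x := by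
    simp [hz, lpTrunc_idem]
  have h2 : z - lpTrunc s z = d • (y - lpTrunc s y) := by
    rw [h1, hz]; abel
  have h3 : ‖z‖ ^ 2 ≤ ‖x‖ ^ 2 + ‖y‖ ^ 2 := by
    rw [← norm_sq_lpTrunc_add s z, h2, h1, norm_smul, norm_smul, hc, hd, one_mul, one_mul]
    nlinarith [norm_sq_lpTrunc_add s x, norm_sq_lpTrunc_add s y, sq_nonneg ‖lpTrunc s y‖,
      sq_nonneg ‖x - lpTrunc s x‖]
  have h4 : f z = ((‖f (lpTrunc s x)‖ + ‖f (y - lpTrunc s y)‖ : ℝ) : ℂ) := by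
    rw [hz, map_add, map_smul, map_smul, smul_eq_mul, smul_eq_mul, ← hc', ← hd']
    push_cast; rfl
  have h5 : ‖f z‖ = ‖f (lpTrunc s x)‖ + ‖f (y - lpTrunc s y)‖ := by
    rw [h4, Complex.norm_real, Real.norm_of_nonneg (by positivity)]
  rw [← h5]
  exact (f.le_opNorm z).trans (by gcongr; exact Real.le_sqrt_of_sq_le h3)

/-- Truncations converge in norm on the dual as well. If `x` almost norms `f` and `s` captures most
of `f x`, adding a tail of size `t` costs only order `t²` in norm, so the value of `f` on the tail,
which is of order `t`, must have a small coefficient. -/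
theorem dual_comp_lpTrunc_tendsto (f : StrongDual ℂ (lp Y 2)) :
    Filter.Tendsto (fun s : Finset ι => f.comp (lpTrunc s)) Filter.atTop (𝓝 f) := by
  rw [Metric.tendsto_nhds]
  intro ε hε
  -- This makes the second-order loss `‖f‖ t² / 2` at most `t ε / 4`, equal to the defect allowed
  -- for `‖f x‖`.
  set t := ε / (2 * (‖f‖ + 1)) with ht
  have hF := norm_nonneg f
  have ht0 : 0 < t := by positivity
  have htF : ‖f‖ * t ≤ ε / 2 := by
    rw [ht, ← mul_div_assoc, div_le_div_iff₀ (by positivity) (by positivity)]; nlinarith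
  obtain ⟨x, hx1, hx⟩ := f.exists_lt_apply_of_lt_opNorm (r := ‖f‖ - t * ε / 4)
    (by have := mul_pos ht0 hε; linarith)
  have hlim : Filter.Tendsto (fun s : Finset ι => ‖f (lpTrunc s x)‖) Filter.atTop (𝓝 ‖f x‖) :=
    (continuous_norm.comp f.continuous).continuousAt.tendsto.comp (lpTrunc_tendsto x)
  filter_upwards [hlim.eventually_const_lt hx] with s hs
  rw [dist_eq_norm]
  refine lt_of_le_of_lt (b := ε / 2) ?_ (by linarith)
  refine ContinuousLinearMap.opNorm_le_of_unit_norm (by positivity) fun y hy => ?_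
  have key := norm_lpTrunc_add_norm_le f s x ((t : ℂ) • y)
  have e1 : ‖f ((t : ℂ) • y - lpTrunc s ((t : ℂ) • y))‖ = t * ‖f (y - lpTrunc s y)‖ := by
    rw [map_smul, ← smul_sub, map_smul, norm_smul, Complex.norm_real, Real.norm_of_nonneg ht0.le]
  have e2 : √(‖x‖ ^ 2 + ‖(t : ℂ) • y‖ ^ 2) ≤ 1 + t ^ 2 / 2 := by
    rw [norm_smul, Complex.norm_real, Real.norm_of_nonneg ht0.le, hy, mul_one]
    refine Real.sqrt_le_iff.mpr ⟨by positivity, ?_⟩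
    have : ‖x‖ ^ 2 ≤ 1 := pow_le_one₀ (norm_nonneg _) hx1.le
    nlinarith [sq_nonneg (t ^ 2)]
  rw [e1] at key
  have e3 : ‖(f.comp (lpTrunc s) - f) y‖ = ‖f (y - lpTrunc s y)‖ := by
    rw [← norm_neg]; simp
  rw [e3]
  have e4 := mul_le_mul_of_nonneg_left e2 hF
  have : t * ‖f (y - lpTrunc s y)‖ ≤ t * (ε / 2) := by
    nlinarith
  exact le_of_mul_le_mul_left this ht0

theorem mem_of_forall_dual {V : Type*} [NormedAddCommGroup V] [NormedSpace ℂ V]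
    (E : Submodule ℂ V) [hE : IsClosed (E : Set V)] {x : V}
    (h : ∀ f : StrongDual ℂ V, (∀ y ∈ E, f y = 0) → f x = 0) : x ∈ E := by
  obtain ⟨g, -, hg⟩ := exists_dual_vector'' ℂ (Submodule.Quotient.mk x : V ⧸ E)
  have hc : Continuous (E.mkQ) :=
    AddMonoidHomClass.continuous_of_bound E.mkQ 1 fun m => by
      rw [one_mul]; exact Submodule.Quotient.norm_mk_le E m
  have := h (g.comp ⟨E.mkQ, hc⟩) fun y hy => by
    have : (Submodule.Quotient.mk y : V ⧸ E) = 0 := (Submodule.Quotient.mk_eq_zero E).mpr hy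
    simp [this]
  have h2 : g (Submodule.Quotient.mk x : V ⧸ E) = 0 := this
  rw [h2] at hg
  have : ‖(Submodule.Quotient.mk x : V ⧸ E)‖ = 0 := by
    rw [← Complex.ofReal_eq_zero]; exact hg.symm
  exact (Submodule.Quotient.mk_eq_zero E).mp (norm_eq_zero.mp this)

theorem exists_dual_extension {E V : Type*} [NormedAddCommGroup E] [NormedSpace ℂ E]
    [NormedAddCommGroup V] [NormedSpace ℂ V] (i : E →ₗᵢ[ℂ] V) (f : StrongDual ℂ E) :
    ∃ g : StrongDual ℂ V, g.comp i.toContinuousLinearMap = f := by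
  obtain ⟨g, hg, -⟩ := exists_extension_norm_eq (LinearMap.range i.toLinearMap)
    (f.comp (i.equivRange.symm.toContinuousLinearEquiv : _ →L[ℂ] E))
  refine ⟨g, ?_⟩
  ext x
  have := hg (i.equivRange x)
  simpa using this

/-- A closed subspace of an `ℓ²`-sum is reflexive as soon as the coordinates of all its bidual
elements come from points. -/
theorem isReflexiveSpace_of_coordinates {E : Type*} [NormedAddCommGroup E] [NormedSpace ℂ E]
    [CompleteSpace E] (e : E →ₗᵢ[ℂ] lp Y 2)
    (h : ∀ (Φ : StrongDual ℂ (StrongDual ℂ E)) (i : ι), ∃ ξ : Y i, ∀ g : StrongDual ℂ (Y i),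
      Φ ((g.comp (lp.evalCLM ℂ Y 2 i)).comp e.toContinuousLinearMap) = g ξ) :
    IsReflexiveSpace E := by
  intro Φ
  choose ξ hξ using h Φ
  have hsum : ∀ (f : StrongDual ℂ (lp Y 2)) (s : Finset ι),
      Φ ((f.comp (lpTrunc s)).comp e.toContinuousLinearMap) =
        f (∑ i ∈ s, lp.single 2 i (ξ i)) := by
    intro f s
    have : (f.comp (lpTrunc s)).comp e.toContinuousLinearMap = ∑ i ∈ s,
        ((f.comp (lp.singleContinuousLinearMap ℂ Y 2 i)).comp (lp.evalCLM ℂ Y 2 i)).comp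
          e.toContinuousLinearMap := by
      ext x
      simp [lpTrunc]
    rw [this, map_sum, map_sum]
    exact Finset.sum_congr rfl fun i _ => by rw [hξ]; rfl
  -- Truncation is contractive, so the partial sums of `ξ` are bounded by `‖Φ‖`; hence `ξ` lies in
  -- the `ℓ²`-sum.
  have hbd : ∀ s : Finset ι, ‖∑ i ∈ s, lp.single (E := Y) 2 i (ξ i)‖ ≤ ‖Φ‖ := by
    intro s
    obtain ⟨g, hg1, hg⟩ := exists_dual_vector'' ℂ (∑ i ∈ s, lp.single (E := Y) 2 i (ξ i))
    have h1 : ‖g (∑ i ∈ s, lp.single (E := Y) 2 i (ξ i))‖ =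
        ‖∑ i ∈ s, lp.single (E := Y) 2 i (ξ i)‖ := by
      rw [hg]; simp
    rw [← h1, ← hsum]
    refine (Φ.le_opNorm _).trans (mul_le_of_le_one_right (norm_nonneg Φ) ?_)
    refine ContinuousLinearMap.opNorm_le_bound _ zero_le_one fun x => ?_
    refine ((g.comp (lpTrunc s)).le_of_opNorm_le ?_ (e x)).trans_eq (by rw [e.norm_map])
    exact (ContinuousLinearMap.opNorm_comp_le _ _).trans
      (mul_le_one₀ hg1 (norm_nonneg _) (norm_lpTrunc_le s))
  have hmem : Memℓp ξ 2 := by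
    refine memℓp_gen' (C := ‖Φ‖ ^ 2) fun s => ?_
    have := norm_sq_sum_single s ξ
    norm_num
    rw [← this]
    gcongr
    exact hbd s
  set x : lp Y 2 := ⟨ξ, hmem⟩
  have hΦ : ∀ f : StrongDual ℂ (lp Y 2), Φ (f.comp e.toContinuousLinearMap) = f x := by
    intro f
    have l1 : Filter.Tendsto
        (fun s : Finset ι => Φ ((f.comp (lpTrunc s)).comp e.toContinuousLinearMap))
        Filter.atTop (𝓝 (Φ (f.comp e.toContinuousLinearMap))) := by
      have hc : Continuous fun g : StrongDual ℂ (lp Y 2) => Φ (g.comp e.toContinuousLinearMap) := by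
        fun_prop
      exact (hc.tendsto f).comp (dual_comp_lpTrunc_tendsto f)
    have l2 : Filter.Tendsto
        (fun s : Finset ι => Φ ((f.comp (lpTrunc s)).comp e.toContinuousLinearMap))
        Filter.atTop (𝓝 (f x)) := by
      simp only [hsum]
      exact (f.continuous.tendsto x).comp (lp.hasSum_single (p := 2) (by norm_num) x)
    exact tendsto_nhds_unique l1 l2
  have hcl : IsClosed (LinearMap.range e.toLinearMap : Set (lp Y 2)) := by
    simpa using! e.isometry.isClosedEmbedding.isClosed_range
  -- A functional vanishing on the image of `E` pulls back to zero, so `Φ` forces it to vanish at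
  -- `x`.
  obtain ⟨u, hu⟩ : x ∈ LinearMap.range e.toLinearMap := mem_of_forall_dual _ fun f hf => by
    have : f.comp e.toContinuousLinearMap = 0 := by
      ext y; exact hf _ ⟨y, rfl⟩
    rw [← hΦ, this, map_zero]
  refine ⟨u, ?_⟩
  ext f
  obtain ⟨g, rfl⟩ := exists_dual_extension e f
  rw [NormedSpace.dual_def, hΦ, ← hu]
  rfl

end Trunc

/-! ### Weak-star continuity and the predual inside the dual. -/

section WeakStar

variable {A X P : Type*} [NormedAddCommGroup A] [NormedSpace ℂ A]
  [NormedAddCommGroup X] [NormedSpace ℂ X] [NormedAddCommGroup P] [NormedSpace ℂ P]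

/-- A linear map `L` out of a dual space `A = P'` is adjointable if all `f ∘ L`, `f ∈ X'`, are
evaluations at points of the predual. -/
def IsAdjointable (D : A ≃ₗᵢ[ℂ] StrongDual ℂ P) (L : A →L[ℂ] X) : Prop :=
  ∀ f : StrongDual ℂ X, ∃ p : P, ∀ c : A, f (L c) = D c p

theorem continuous_weakTopology_iff {Z : Type*} (t : TopologicalSpace Z) (g : Z → X) :
    Continuous[t, weakTopology X] g ↔
      ∀ f : StrongDual ℂ X, Continuous[t, inferInstance] fun z => f (g z) := by
  rw [continuous_induced_rng]
  constructor
  · intro h f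
    exact (WeakBilin.eval_continuous (topDualPairing ℂ X).flip f).comp h
  · intro h
    exact WeakBilin.continuous_of_continuous_eval _ h

theorem continuous_weakStar_apply (D : A ≃ₗᵢ[ℂ] StrongDual ℂ P) (p : P) :
    Continuous[weakStarTopology D, _] fun c : A => D c p := by
  let _ := weakStarTopology D
  exact (WeakDual.eval_continuous p).comp continuous_induced_dom

theorem exists_predual_of_continuous (D : A ≃ₗᵢ[ℂ] StrongDual ℂ P) (g : A →ₗ[ℂ] ℂ)
    (hg : Continuous[weakStarTopology D, _] g) : ∃ p : P, ∀ c, g c = D c p := by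
  let k : WeakDual ℂ P →ₗ[ℂ] ℂ :=
    g ∘ₗ D.symm.toLinearEquiv.toLinearMap ∘ₗ (WeakDual.toStrongDual (𝕜 := ℂ) (E := P)).toLinearMap
  have hk : Continuous k := by
    let _ := weakStarTopology D
    have h2 : Continuous fun w : WeakDual ℂ P => D.symm (WeakDual.toStrongDual w) := by
      rw [continuous_induced_rng]
      have : (fun a : A => StrongDual.toWeakDual (D a)) ∘
          (fun w : WeakDual ℂ P => D.symm (WeakDual.toStrongDual w)) = id := by
        funext w; simp
      rw [this]
      exact continuous_id
    exact hg.comp h2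
  -- A functional continuous for the weak topology of a pairing is given by that pairing.
  obtain ⟨p, hp⟩ := LinearMap.dualEmbedding_surjective (topDualPairing ℂ P) ⟨k, hk⟩
  refine ⟨p, fun c => ?_⟩
  have := DFunLike.congr_fun hp (StrongDual.toWeakDual (D c))
  have h3 : k (StrongDual.toWeakDual (D c)) = g c := by simp [k]
  rw [← h3]
  exact this.symm

theorem isAdjointable_iff (D : A ≃ₗᵢ[ℂ] StrongDual ℂ P) (L : A →L[ℂ] X) :
    IsAdjointable D L ↔ Continuous[weakStarTopology D, weakTopology X] L := by
  rw [continuous_weakTopology_iff]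
  refine forall_congr' fun f => ⟨?_, fun h => ?_⟩
  · rintro ⟨p, hp⟩
    simp only [hp]
    exact continuous_weakStar_apply D p
  · exact exists_predual_of_continuous D (f.comp L).toLinearMap h

/-- The isometric embedding of the predual in the dual. -/
noncomputable def predualEmbedding (D : A ≃ₗᵢ[ℂ] StrongDual ℂ P) : P →ₗᵢ[ℂ] StrongDual ℂ A where
  toFun p := (NormedSpace.inclusionInDoubleDual ℂ P p).comp
    (D.toContinuousLinearEquiv : A →L[ℂ] StrongDual ℂ P)
  map_add' p q := by ext; simp
  map_smul' c p := by ext; simp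
  norm_map' p := by
    refine Eq.trans ?_ ((NormedSpace.inclusionInDoubleDualLi ℂ).norm_map p)
    exact ContinuousLinearMap.opNorm_comp_linearIsometryEquiv
      (NormedSpace.inclusionInDoubleDual ℂ P p) D

theorem isClosed_range_predualEmbedding [CompleteSpace P] (D : A ≃ₗᵢ[ℂ] StrongDual ℂ P) :
    IsClosed (Set.range (predualEmbedding D)) :=
  (predualEmbedding D).isometry.isClosedEmbedding.isClosed_range

theorem mem_range_predualEmbedding_iff (D : A ≃ₗᵢ[ℂ] StrongDual ℂ P) (g : StrongDual ℂ A) :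
    g ∈ Set.range (predualEmbedding D) ↔ ∃ p : P, ∀ c, g c = D c p := by
  refine exists_congr fun p => ⟨fun h c => by rw [← h]; rfl, fun h => ?_⟩
  ext c
  exact (h c).symm

end WeakStar

theorem exists_dual_extension_of_bound {Z W : Type*} [NormedAddCommGroup Z] [NormedSpace ℂ Z]
    [NormedAddCommGroup W] [NormedSpace ℂ W] (i : Z →ₗ[ℂ] W) (hi : Function.Injective i)
    (φ : Z →ₗ[ℂ] ℂ) {C : ℝ} (hC : 0 ≤ C) (h : ∀ z, ‖φ z‖ ≤ C * ‖i z‖) :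
    ∃ ψ : StrongDual ℂ W, ‖ψ‖ ≤ C ∧ ∀ z, ψ (i z) = φ z := by
  let e := LinearEquiv.ofInjective i hi
  have hb : ∀ w, ‖(φ ∘ₗ e.symm.toLinearMap) w‖ ≤ C * ‖w‖ := fun w => by
    have := h (e.symm w)
    have h2 : i (e.symm w) = w := congrArg Subtype.val (e.apply_symm_apply w)
    rw [h2] at this
    exact this
  obtain ⟨ψ, h1, h2⟩ := exists_extension_norm_eq (LinearMap.range i)
    ((φ ∘ₗ e.symm.toLinearMap).mkContinuous C hb)
  refine ⟨ψ, h2.trans_le (LinearMap.mkContinuous_norm_le _ hC _), fun z => ?_⟩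
  have := h1 (e z)
  simpa [e] using this

/-! ### The Davis–Figiel–Johnson–Pełczyński interpolation space of an adjointable map. -/

section Interpolation

variable {A X : Type*} [NormedAddCommGroup A] [NormedSpace ℂ A]
  [NormedAddCommGroup X] [NormedSpace ℂ X]

/-- The map `(b, z) ↦ 2ⁿ L b + 2⁻ⁿ z`. -/
noncomputable def interpSum (L : A →L[ℂ] X) (n : ℕ) : A × X →L[ℂ] X :=
  (2 ^ n : ℂ) • L.comp (ContinuousLinearMap.fst ℂ A X) +
    ((2 ^ n : ℂ)⁻¹) • ContinuousLinearMap.snd ℂ A X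

theorem interpSum_apply (L : A →L[ℂ] X) (n : ℕ) (m : A × X) :
    interpSum L n m = (2 ^ n : ℂ) • L m.1 + ((2 ^ n : ℂ)⁻¹) • m.2 := by
  simp [interpSum]

/-- The kernel of `interpSum`. -/
noncomputable def interpKer (L : A →L[ℂ] X) (n : ℕ) : Submodule ℂ (A × X) :=
  LinearMap.ker (interpSum L n).toLinearMap

instance (L : A →L[ℂ] X) (n : ℕ) : IsClosed (interpKer L n : Set (A × X)) :=
  (interpSum L n).isClosed_ker

/-- `X` with the equivalent norm `inf {max ‖b‖ ‖z‖ : x = 2ⁿ L b + 2⁻ⁿ z}`, as a quotient. -/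
abbrev InterpFiber (L : A →L[ℂ] X) (n : ℕ) : Type _ := (A × X) ⧸ interpKer L n

/-- The quotient norm is an infimum that need not be attained; the factor 2 leaves room for a
representative. -/
theorem InterpFiber.exists_rep {L : A →L[ℂ] X} {n : ℕ} (y : InterpFiber L n) :
    ∃ m : A × X, (Submodule.Quotient.mk m : InterpFiber L n) = y ∧ ‖m‖ ≤ 2 * ‖y‖ := by
  by_cases hy : y = 0
  · exact ⟨0, by simp [hy], by simp⟩
  · obtain ⟨m, hm, hm'⟩ := Submodule.Quotient.norm_mk_lt y (norm_pos_iff.mpr hy)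
    exact ⟨m, hm, by linarith⟩

/-- The identification of `InterpFiber L n` with `X`. -/
noncomputable def fiberTo (L : A →L[ℂ] X) (n : ℕ) : InterpFiber L n →L[ℂ] X :=
  LinearMap.mkContinuous ((interpKer L n).liftQ (interpSum L n).toLinearMap le_rfl)
    (‖interpSum L n‖ * 2) fun y => by
      obtain ⟨m, rfl, hm⟩ := y.exists_rep
      refine ((interpSum L n).le_opNorm m).trans ?_
      rw [mul_assoc]
      gcongr

theorem fiberTo_mk (L : A →L[ℂ] X) (n : ℕ) (m : A × X) :
    fiberTo L n (Submodule.Quotient.mk m) = interpSum L n m := rfl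

theorem fiberTo_injective (L : A →L[ℂ] X) (n : ℕ) : Function.Injective (fiberTo L n) := by
  rw [injective_iff_map_eq_zero]
  intro y hy
  obtain ⟨m, rfl⟩ := Submodule.Quotient.mk_surjective _ y
  exact (Submodule.Quotient.mk_eq_zero _).mpr hy

/-- The inverse of `fiberTo`. -/
noncomputable def toFiber (L : A →L[ℂ] X) (n : ℕ) : X →L[ℂ] InterpFiber L n :=
  LinearMap.mkContinuous
    ((2 ^ n : ℂ) • (interpKer L n).mkQ ∘ₗ LinearMap.inr ℂ A X) (2 ^ n) fun z => by
      rw [LinearMap.smul_apply, norm_smul]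
      have h := Submodule.Quotient.norm_mk_le (interpKer L n) ((0 : A), z)
      have h2 : ‖((0 : A), z)‖ = ‖z‖ := by simp [Prod.norm_def]
      rw [h2] at h
      simpa using h

theorem fiberTo_toFiber (L : A →L[ℂ] X) (n : ℕ) (z : X) : fiberTo L n (toFiber L n z) = z := by
  have : toFiber L n z = (2 ^ n : ℂ) • Submodule.Quotient.mk ((0 : A), z) := rfl
  rw [this, map_smul, fiberTo_mk, interpSum_apply]
  simp

theorem toFiber_fiberTo (L : A →L[ℂ] X) (n : ℕ) (y : InterpFiber L n) :
    toFiber L n (fiberTo L n y) = y :=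
  fiberTo_injective L n (fiberTo_toFiber L n _)

/-- The class of `(2⁻ⁿ c, 0)`. -/
noncomputable def interpFun (L : A →L[ℂ] X) (n : ℕ) (c : A) : InterpFiber L n :=
  Submodule.Quotient.mk ((2 ^ n : ℂ)⁻¹ • c, 0)

theorem fiberTo_interpFun (L : A →L[ℂ] X) (n : ℕ) (c : A) :
    fiberTo L n (interpFun L n c) = L c := by
  rw [interpFun, fiberTo_mk, interpSum_apply]
  simp

theorem interpFun_eq (L : A →L[ℂ] X) (n : ℕ) (c : A) : interpFun L n c = toFiber L n (L c) := by
  rw [← fiberTo_interpFun L n, toFiber_fiberTo]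

theorem norm_interpFun_le (L : A →L[ℂ] X) (n : ℕ) (c : A) :
    ‖interpFun L n c‖ ≤ (1 / 2) ^ n * ‖c‖ := by
  refine (Submodule.Quotient.norm_mk_le _ _).trans ?_
  simp [Prod.norm_def, norm_smul]

theorem hasSum_geometric_sq (r : ℝ) :
    HasSum (fun n : ℕ => ((1 / 2 : ℝ) ^ n * r) ^ 2) (4 / 3 * r ^ 2) := by
  have h := (hasSum_geometric_of_lt_one (r := (1 / 4 : ℝ)) (by norm_num) (by norm_num)).mul_right
    (r ^ 2)
  norm_num at h
  have e : (fun n : ℕ => ((1 / 2 : ℝ) ^ n * r) ^ 2) = fun n : ℕ => (1 / 4 : ℝ) ^ n * r ^ 2 := by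
    funext n
    rw [mul_pow, ← pow_mul, mul_comm n 2, pow_mul]
    norm_num
  rw [e]
  exact h

theorem memℓp_interpFun (L : A →L[ℂ] X) (c : A) : Memℓp (fun n => interpFun L n c) 2 := by
  refine memℓp_gen ?_
  norm_num
  exact Summable.of_nonneg_of_le (fun n => by positivity)
    (fun n => pow_le_pow_left₀ (norm_nonneg _) (norm_interpFun_le L n c) 2)
    (hasSum_geometric_sq ‖c‖).summable

theorem lp_hasSum_norm_sq {Y : ℕ → Type*} [∀ i, NormedAddCommGroup (Y i)] (x : lp Y 2) :
    HasSum (fun n => ‖x n‖ ^ 2) (‖x‖ ^ 2) := by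
  have := lp.hasSum_norm (p := 2) (by norm_num) x
  simpa using this

/-- `c ↦ (L c)ₙ`, with values in the `ℓ²`-sum of the fibers. -/
noncomputable def interpEmb (L : A →L[ℂ] X) : A →L[ℂ] lp (InterpFiber L) 2 :=
  LinearMap.mkContinuous
    { toFun := fun c => ⟨fun n => interpFun L n c, memℓp_interpFun L c⟩
      map_add' := fun c d => by
        ext n
        simp only [lp.coeFn_add, Pi.add_apply, interpFun_eq, map_add]
      map_smul' := fun z c => by
        ext n
        simp only [lp.coeFn_smul, Pi.smul_apply, interpFun_eq, map_smul, RingHom.id_apply] }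
    -- A crude bound for the square root of `4 / 3`.
    2 fun c => by
      set x : lp (InterpFiber L) 2 := ⟨fun n => interpFun L n c, memℓp_interpFun L c⟩
      have h : ‖x‖ ^ 2 ≤ 4 / 3 * ‖c‖ ^ 2 := hasSum_le
        (fun n => pow_le_pow_left₀ (norm_nonneg _) (norm_interpFun_le L n c) 2)
        (lp_hasSum_norm_sq x) (hasSum_geometric_sq ‖c‖)
      change ‖x‖ ≤ 2 * ‖c‖
      refine le_of_sq_le_sq ?_ (by positivity)
      nlinarith [sq_nonneg ‖c‖]

theorem interpEmb_apply (L : A →L[ℂ] X) (c : A) (n : ℕ) : interpEmb L c n = interpFun L n c := rfl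

/-- The interpolation space between `A` and `X` along `L`. -/
def InterpSpace (L : A →L[ℂ] X) : Type _ :=
  (LinearMap.range (interpEmb L).toLinearMap).topologicalClosure

noncomputable instance (L : A →L[ℂ] X) : NormedAddCommGroup (InterpSpace L) :=
  inferInstanceAs (NormedAddCommGroup
    (LinearMap.range (interpEmb L).toLinearMap).topologicalClosure)

noncomputable instance (L : A →L[ℂ] X) : NormedSpace ℂ (InterpSpace L) :=
  inferInstanceAs (NormedSpace ℂ (LinearMap.range (interpEmb L).toLinearMap).topologicalClosure)

instance [CompleteSpace A] [CompleteSpace X] (L : A →L[ℂ] X) : CompleteSpace (InterpSpace L) :=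
  (LinearMap.range (interpEmb L).toLinearMap).isClosed_topologicalClosure.completeSpace_coe

/-- The inclusion of the interpolation space in the `ℓ²`-sum. -/
noncomputable def interpIncl (L : A →L[ℂ] X) : InterpSpace L →ₗᵢ[ℂ] lp (InterpFiber L) 2 :=
  (LinearMap.range (interpEmb L).toLinearMap).topologicalClosure.subtypeₗᵢ

/-- The canonical map of `A` to the interpolation space. -/
noncomputable def toInterp (L : A →L[ℂ] X) : A →ₗ[ℂ] InterpSpace L :=
  (Submodule.inclusion (LinearMap.range (interpEmb L).toLinearMap).le_topologicalClosure) ∘ₗ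
    (interpEmb L).toLinearMap.rangeRestrict

theorem norm_toInterp_eq (L : A →L[ℂ] X) (c : A) : ‖toInterp L c‖ = ‖interpEmb L c‖ := rfl

theorem norm_toInterp_le (L : A →L[ℂ] X) (c : A) : ‖toInterp L c‖ ≤ 2 * ‖c‖ :=
  (interpEmb L).le_of_opNorm_le (LinearMap.mkContinuous_norm_le _ (by norm_num) _) c

theorem denseRange_toInterp (L : A →L[ℂ] X) : DenseRange (toInterp L) := by
  intro x
  rw [(interpIncl L).isometry.isEmbedding.closure_eq_preimage_closure_image, Set.mem_preimage]
  have : (interpIncl L) '' Set.range (toInterp L) = Set.range (interpEmb L) := by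
    rw [← Set.range_comp]; rfl
  rw [this]
  exact x.2

/-- The pair `(R, R')` acts on representatives in every fiber, because `L` intertwines `R` and `R'`.
This is how module actions pass to the interpolation space. -/
theorem norm_toInterp_map_le {L : A →L[ℂ] X} {R : A →ₗ[ℂ] A} {R' : X →ₗ[ℂ] X} {C : ℝ}
    (hC : 0 ≤ C) (hR : ∀ a, ‖R a‖ ≤ C * ‖a‖) (hR' : ∀ x, ‖R' x‖ ≤ C * ‖x‖)
    (h : ∀ a, L (R a) = R' (L a)) (c : A) : ‖toInterp L (R c)‖ ≤ C * ‖toInterp L c‖ := by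
  rw [norm_toInterp_eq, norm_toInterp_eq]
  have key : ∀ n, ‖interpFun L n (R c)‖ ≤ C * ‖interpFun L n c‖ := by
    intro n
    refine le_of_forall_pos_le_add fun ε hε => ?_
    obtain ⟨m, hm, hm'⟩ := Submodule.Quotient.norm_mk_lt (interpFun L n c)
      -- Dividing by `C + 1` rather than `C` covers the case `C = 0`.
      (show 0 < ε / (C + 1) by positivity)
    have h1 : interpFun L n (R c) = Submodule.Quotient.mk (R m.1, R' m.2) := by
      apply fiberTo_injective
      have : interpSum L n m = L c := by rw [← fiberTo_mk, hm, fiberTo_interpFun]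
      rw [fiberTo_interpFun, fiberTo_mk, h, ← this, interpSum_apply, interpSum_apply]
      simp [h]
    rw [h1]
    have h2 : ‖(R m.1, R' m.2)‖ ≤ C * ‖m‖ :=
      max_le ((hR _).trans (by gcongr; exact norm_fst_le m))
        ((hR' _).trans (by gcongr; exact norm_snd_le m))
    refine (Submodule.Quotient.norm_mk_le _ _).trans (h2.trans ?_)
    calc C * ‖m‖ ≤ C * (‖interpFun L n c‖ + ε / (C + 1)) := by gcongr
      _ = C * ‖interpFun L n c‖ + ε * (C / (C + 1)) := by ring
      _ ≤ C * ‖interpFun L n c‖ + ε := by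
        gcongr
        exact mul_le_of_le_one_right hε.le ((div_le_one (by positivity)).mpr (by linarith))
  have h3 := (lp_hasSum_norm_sq (interpEmb L c)).mul_left (C ^ 2)
  have h4 : ‖interpEmb L (R c)‖ ^ 2 ≤ C ^ 2 * ‖interpEmb L c‖ ^ 2 :=
    hasSum_le (fun n => by
      rw [← mul_pow]; exact pow_le_pow_left₀ (norm_nonneg _) (key n) 2)
      (lp_hasSum_norm_sq (interpEmb L (R c))) h3
  refine le_of_sq_le_sq ?_ (by positivity)
  rwa [mul_pow]

/-- Near-optimal representatives in the fibers split `c` at every scale `2ⁿ`; this is the only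
information on the interpolation norm that the bilinear estimate needs. -/
theorem exists_approximation (L : A →L[ℂ] X) (c : A) :
    ∃ (b : ℕ → A) (γ : ℕ → ℝ), (∀ n, 0 ≤ γ n) ∧ (∀ n, ‖b n‖ ≤ 2 ^ n * γ n) ∧
      (∀ n, ‖L (c - b n)‖ ≤ (2 ^ n)⁻¹ * γ n) ∧ HasSum (fun n => γ n ^ 2) (4 * ‖toInterp L c‖ ^ 2) := by
  choose m hm hm' using fun n => (interpFun L n c).exists_rep
  refine ⟨fun n => (2 ^ n : ℂ) • (m n).1, fun n => 2 * ‖interpFun L n c‖, fun n => by positivity,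
    fun n => ?_, fun n => ?_, ?_⟩
  · rw [norm_smul]
    simp only [norm_pow, Complex.norm_ofNat]
    gcongr
    exact (norm_fst_le _).trans (hm' n)
  · have : interpSum L n (m n) = L c := by rw [← fiberTo_mk, hm, fiberTo_interpFun]
    rw [map_sub, ← this, interpSum_apply, map_smul, add_sub_cancel_left, norm_smul]
    simp only [norm_inv, norm_pow, Complex.norm_ofNat]
    gcongr
    exact (norm_snd_le _).trans (hm' n)
  · have e : (fun n => (2 * ‖interpFun L n c‖) ^ 2) = fun n => 4 * ‖interpEmb L c n‖ ^ 2 := by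
      funext n
      rw [interpEmb_apply]; ring
    rw [e]
    exact (lp_hasSum_norm_sq (interpEmb L c)).mul_left 4

/-- The `n`-th coordinate of the interpolation space, as a map to `X`. -/
noncomputable def interpTo (L : A →L[ℂ] X) (n : ℕ) : InterpSpace L →L[ℂ] X :=
  (fiberTo L n).comp ((lp.evalCLM ℂ (InterpFiber L) 2 n).comp (interpIncl L).toContinuousLinearMap)

theorem interpTo_toInterp (L : A →L[ℂ] X) (n : ℕ) (c : A) : interpTo L n (toInterp L c) = L c :=
  fiberTo_interpFun L n c

/-- On the dense image of `A` every coordinate is `L c`; so a point is a single vector of `X`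
measured in a sequence of norms. -/
theorem interpTo_eq (L : A →L[ℂ] X) (n m : ℕ) : interpTo L n = interpTo L m := by
  ext x
  refine congrFun ((denseRange_toInterp L).equalizer (interpTo L n).continuous
    (interpTo L m).continuous ?_) x
  ext c
  simp [interpTo_toInterp]

theorem norm_comp_interpTo_le (L : A →L[ℂ] X) (n : ℕ) (f : StrongDual ℂ X) :
    ‖f.comp (interpTo L n)‖ ≤ 4 * ‖((2 ^ n : ℂ) • f.comp L, (2 ^ n : ℂ)⁻¹ • f)‖ := by
  set N := ‖((2 ^ n : ℂ) • f.comp L, (2 ^ n : ℂ)⁻¹ • f)‖ with hN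
  have h1 : ‖(2 ^ n : ℂ) • f.comp L‖ ≤ N := le_max_left _ _
  have h2 : ‖(2 ^ n : ℂ)⁻¹ • f‖ ≤ N := le_max_right _ _
  refine ContinuousLinearMap.opNorm_le_bound _ (by positivity) fun x => ?_
  set y : InterpFiber L n := interpIncl L x n with hy
  have hyx : ‖y‖ ≤ ‖x‖ := by
    rw [← (interpIncl L).norm_map x]
    exact lp.norm_apply_le_norm (by norm_num) _ n
  obtain ⟨m, hm, hm'⟩ := y.exists_rep
  have h3 : f.comp (interpTo L n) x =
      ((2 ^ n : ℂ) • f.comp L) m.1 + ((2 ^ n : ℂ)⁻¹ • f) m.2 := by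
    have : interpTo L n x = fiberTo L n y := rfl
    rw [ContinuousLinearMap.comp_apply, this, ← hm, fiberTo_mk, interpSum_apply]
    simp
  rw [h3]
  have h4 : ‖((2 ^ n : ℂ) • f.comp L) m.1‖ ≤ N * (2 * ‖x‖) :=
    ContinuousLinearMap.le_of_opNorm_le_of_le _ h1
      ((norm_fst_le m).trans (hm'.trans (by gcongr)))
  have h5 : ‖((2 ^ n : ℂ)⁻¹ • f) m.2‖ ≤ N * (2 * ‖x‖) :=
    ContinuousLinearMap.le_of_opNorm_le_of_le _ h2
      ((norm_snd_le m).trans (hm'.trans (by gcongr)))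
  calc _ ≤ N * (2 * ‖x‖) + N * (2 * ‖x‖) := (norm_add_le _ _).trans (add_le_add h4 h5)
    _ = 4 * N * ‖x‖ := by ring

variable {P : Type*} [NormedAddCommGroup P] [NormedSpace ℂ P]

/-- The weak compactness argument: `ζ`, the image of `Φ` in `X''`, lies within a multiple of `2⁻ⁿ`
of a point of `L(A)` for every `n`, hence in the closed subspace `X` of `X''`. -/
theorem bidual_interpTo_mem {D : A ≃ₗᵢ[ℂ] StrongDual ℂ P} {L : A →L[ℂ] X} [CompleteSpace X]
    (hL : IsAdjointable D L) (Φ : StrongDual ℂ (StrongDual ℂ (InterpSpace L))) :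
    ∃ z : X, ∀ n, ∀ f : StrongDual ℂ X, Φ (f.comp (interpTo L n)) = f z := by
  let ζ : StrongDual ℂ (StrongDual ℂ X) :=
    Φ.comp ((ContinuousLinearMap.compL ℂ (InterpSpace L) X ℂ).flip (interpTo L 0))
  have hζ : ∀ f n, ζ f = Φ (f.comp (interpTo L n)) := fun f n => by
    rw [interpTo_eq L n 0]; rfl
  have happrox : ∀ n : ℕ, ∃ x : X,
      ‖ζ - NormedSpace.inclusionInDoubleDual ℂ X x‖ ≤ (1 / 2) ^ n * (4 * ‖Φ‖) := by
    intro n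
    let i : StrongDual ℂ X →ₗ[ℂ] StrongDual ℂ A × StrongDual ℂ X :=
      { toFun := fun f => ((2 ^ n : ℂ) • f.comp L, (2 ^ n : ℂ)⁻¹ • f)
        map_add' := fun f g => by simp
        map_smul' := fun c f => by
          simp [smul_comm c] }
    have hi : Function.Injective i := fun f g h => by
      have h2 : (2 ^ n : ℂ)⁻¹ • f = (2 ^ n : ℂ)⁻¹ • g := congrArg Prod.snd h
      exact smul_right_injective _ (inv_ne_zero (pow_ne_zero n two_ne_zero)) h2
    -- Hahn–Banach splits `ζ` into an `A''` part and an `X''` part. As `f ∘ L` lies in the predual,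
    -- only the restriction `q` of the first part to `P` matters, and `q` is an element of `A`; the
    -- second part carries the factor `2⁻ⁿ`.
    obtain ⟨ψ, hψ, hψi⟩ := exists_dual_extension_of_bound i hi ζ.toLinearMap
      (C := 4 * ‖Φ‖) (by positivity) fun f => by
        change ‖ζ f‖ ≤ _
        rw [hζ f n]
        refine (Φ.le_opNorm _).trans ?_
        rw [mul_comm 4, mul_assoc]
        gcongr
        exact norm_comp_interpTo_le L n f
    let q : StrongDual ℂ P := ψ.comp ((ContinuousLinearMap.inl ℂ _ _).comp
      (predualEmbedding D).toContinuousLinearMap)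
    refine ⟨L ((2 ^ n : ℂ) • D.symm q), ?_⟩
    refine ContinuousLinearMap.opNorm_le_bound _ (by positivity) fun f => ?_
    obtain ⟨p, hp⟩ := hL f
    have hp' : f.comp L = predualEmbedding D p := by ext c; exact hp c
    have h1 : ζ f = (2 ^ n : ℂ) * ψ (f.comp L, 0) + (2 ^ n : ℂ)⁻¹ * ψ (0, f) := by
      rw [← smul_eq_mul, ← smul_eq_mul, ← map_smul, ← map_smul, ← map_add]
      refine (hψi f).symm.trans (congrArg ψ ?_)
      refine Prod.ext ?_ ?_ <;> ext a <;> simp <;> rfl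
    have h2 : f (L ((2 ^ n : ℂ) • D.symm q)) = (2 ^ n : ℂ) * ψ (f.comp L, 0) := by
      rw [map_smul, map_smul, hp, LinearIsometryEquiv.apply_symm_apply, hp', smul_eq_mul]
      rfl
    have h3 : (ζ - NormedSpace.inclusionInDoubleDual ℂ X (L ((2 ^ n : ℂ) • D.symm q))) f =
        (2 ^ n : ℂ)⁻¹ * ψ (0, f) := by
      rw [_root_.sub_apply, NormedSpace.dual_def, h1, h2]; ring
    rw [h3, norm_mul]
    have h4 : ‖((0 : StrongDual ℂ A), f)‖ = ‖f‖ := by simp [Prod.norm_def]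
    have h5 := ψ.le_of_opNorm_le hψ ((0 : StrongDual ℂ A), f)
    rw [h4] at h5
    simp only [norm_inv, norm_pow, Complex.norm_ofNat, one_div, inv_pow]
    rw [mul_assoc]
    gcongr
  have hcl := isClosed_range_predualEmbedding (LinearIsometryEquiv.refl ℂ (StrongDual ℂ X))
  choose x hx using happrox
  have hlim : Filter.Tendsto (fun n => predualEmbedding (LinearIsometryEquiv.refl ℂ (StrongDual ℂ X)) (x n))
      Filter.atTop (𝓝 ζ) := by
    rw [tendsto_iff_norm_sub_tendsto_zero]
    have h0 : Filter.Tendsto (fun n : ℕ => (1 / 2 : ℝ) ^ n * (4 * ‖Φ‖)) Filter.atTop (𝓝 0) := by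
      have := (tendsto_pow_atTop_nhds_zero_of_lt_one (r := (1 / 2 : ℝ)) (by norm_num)
        (by norm_num)).mul_const (4 * ‖Φ‖)
      simpa using this
    refine squeeze_zero (fun n => norm_nonneg _) (fun n => ?_) h0
    rw [norm_sub_rev]
    exact hx n
  obtain ⟨z, hz⟩ := hcl.mem_of_tendsto hlim (Filter.Eventually.of_forall fun n => ⟨x n, rfl⟩)
  refine ⟨z, fun n f => ?_⟩
  rw [← hζ, ← hz]
  rfl

theorem isReflexiveSpace_interpSpace {D : A ≃ₗᵢ[ℂ] StrongDual ℂ P} {L : A →L[ℂ] X}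
    [CompleteSpace A] [CompleteSpace X] (hL : IsAdjointable D L) :
    IsReflexiveSpace (InterpSpace L) := by
  refine isReflexiveSpace_of_coordinates (interpIncl L) fun Φ n => ?_
  obtain ⟨z, hz⟩ := bidual_interpTo_mem hL Φ
  refine ⟨toFiber L n z, fun g => ?_⟩
  have := hz n (g.comp (toFiber L n))
  rw [ContinuousLinearMap.comp_apply] at this
  rw [← this]
  congr 1
  ext x
  exact congrArg g (toFiber_fiberTo L n _).symm

/-- Truncated functionals are finite sums of functionals factoring through `L`, so they restrict to
predual elements; the predual is norm closed in `A'` and truncations converge in norm. -/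
theorem exists_predual_toInterp [CompleteSpace P] {D : A ≃ₗᵢ[ℂ] StrongDual ℂ P} {L : A →L[ℂ] X}
    (hL : IsAdjointable D L) (ν : StrongDual ℂ (InterpSpace L)) :
    ∃ p : P, ∀ c, ν (toInterp L c) = D c p := by
  obtain ⟨f, rfl⟩ := exists_dual_extension (interpIncl L) ν
  have hc : Continuous fun g : StrongDual ℂ (lp (InterpFiber L) 2) => g.comp (interpEmb L) := by
    fun_prop
  refine (mem_range_predualEmbedding_iff D (f.comp (interpEmb L))).mp ?_
  refine (isClosed_range_predualEmbedding D).mem_of_tendsto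
    ((hc.tendsto f).comp (dual_comp_lpTrunc_tendsto f)) (Filter.Eventually.of_forall fun s => ?_)
  have hn : ∀ n, ∃ p : P, ∀ c,
      f (lp.single 2 n (interpFun L n c)) = D c p := fun n => by
    obtain ⟨p, hp⟩ := hL ((f.comp (lp.singleContinuousLinearMap ℂ (InterpFiber L) 2 n)).comp
      (toFiber L n))
    exact ⟨p, fun c => by rw [← hp, interpFun_eq]; rfl⟩
  choose p hp using hn
  refine (mem_range_predualEmbedding_iff D _).mpr ⟨∑ n ∈ s, p n, fun c => ?_⟩
  simp only [Function.comp_apply, ContinuousLinearMap.comp_apply]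
  rw [lpTrunc_apply, map_sum, map_sum]
  exact Finset.sum_congr rfl fun n _ => hp n c

end Interpolation

/-! ### Interpolation of bilinear forms and of actions. -/

section Bilinear

theorem sum_shift_sq_le {γ : ℕ → ℝ} {G : ℝ} (h : HasSum (fun n => γ n ^ 2) G) (i N : ℕ) :
    ∑ n ∈ Finset.range N, γ (i + n) ^ 2 ≤ G := by
  have h1 := sum_le_hasSum (Finset.range (i + N)) (fun n _ => sq_nonneg (γ n)) h
  rw [Finset.sum_range_add] at h1
  have h2 : 0 ≤ ∑ n ∈ Finset.range i, γ n ^ 2 := Finset.sum_nonneg fun n _ => sq_nonneg (γ n)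
  linarith

theorem sum_shift_mul_le {γ δ : ℕ → ℝ} {G D : ℝ} (hG : 0 ≤ G) (hD : 0 ≤ D)
    (hγ : HasSum (fun n => γ n ^ 2) (G ^ 2)) (hδ : HasSum (fun n => δ n ^ 2) (D ^ 2))
    (i j N : ℕ) : ∑ n ∈ Finset.range N, γ (i + n) * δ (j + n) ≤ G * D := by
  refine (Real.sum_mul_le_sqrt_mul_sqrt _ _ _).trans ?_
  gcongr
  · exact Real.sqrt_le_iff.mpr ⟨hG, sum_shift_sq_le hγ i N⟩
  · exact Real.sqrt_le_iff.mpr ⟨hD, sum_shift_sq_le hδ j N⟩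

variable {A X Y : Type*} [NormedAddCommGroup A] [NormedSpace ℂ A]
  [NormedAddCommGroup X] [NormedSpace ℂ X] [NormedAddCommGroup Y] [NormedSpace ℂ Y]

/-- Bilinear interpolation: a form that is bounded for the norms `‖L x‖`, `‖y‖` and for the norms
`‖x‖`, `‖M y‖` is bounded on the two interpolation spaces. -/
theorem norm_bilinear_le_interp (B : A →ₗ[ℂ] A →ₗ[ℂ] ℂ) (L : A →L[ℂ] X) (M : A →L[ℂ] Y) {t : ℝ}
    (ht : 0 ≤ t) (hB : ∀ x y, ‖B x y‖ ≤ t * (‖x‖ * ‖y‖)) (hL : ∀ x y, ‖B x y‖ ≤ t * (‖L x‖ * ‖y‖))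
    (hM : ∀ x y, ‖B x y‖ ≤ t * (‖x‖ * ‖M y‖)) (x y : A) :
    ‖B x y‖ ≤ 24 * t * (‖toInterp L x‖ * ‖toInterp M y‖) := by
  obtain ⟨b, γ, hγ0, hb, hLb, hγ⟩ := exists_approximation L x
  obtain ⟨a, δ, hδ0, ha, hMa, hδ⟩ := exists_approximation M y
  set G := 2 * ‖toInterp L x‖ with hG
  set D := 2 * ‖toInterp M y‖ with hD
  have hG0 : 0 ≤ G := by positivity
  have hD0 : 0 ≤ D := by positivity
  have hγ' : HasSum (fun n => γ n ^ 2) (G ^ 2) := by rw [hG, mul_pow]; norm_num; exact hγ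
  have hδ' : HasSum (fun n => δ n ^ 2) (D ^ 2) := by rw [hD, mul_pow]; norm_num; exact hδ
  -- In each increment the factor `2⁻ⁿ` from `L` or `M` cancels the growth `2ⁿ` of the other
  -- variable. What remains are products of `γ` and `δ`, summable by Cauchy–Schwarz.
  have hstep : ∀ n, ‖B (b (n + 1)) (a (n + 1)) - B (b n) (a n)‖ ≤
      t * (3 * (γ (0 + n) * δ (1 + n)) + γ (1 + n) * δ (1 + n) + γ (0 + n) * δ (0 + n)) := by
    intro n
    rw [zero_add, add_comm 1 n]
    have h2 : (0 : ℝ) < 2 ^ n := by positivity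
    have e : B (b (n + 1)) (a (n + 1)) - B (b n) (a n) =
        B (b (n + 1) - b n) (a (n + 1)) + B (b n) (a (n + 1) - a n) := by
      simp only [map_sub, LinearMap.sub_apply]; ring
    have e1 : ‖L (b (n + 1) - b n)‖ ≤ (2 ^ n)⁻¹ * (γ n + γ (n + 1) / 2) := by
      have : b (n + 1) - b n = (x - b n) - (x - b (n + 1)) := by abel
      rw [this, map_sub]
      refine (norm_sub_le _ _).trans ((add_le_add (hLb n) (hLb (n + 1))).trans_eq ?_)
      rw [pow_succ]; field_simp
    have e2 : ‖M (a (n + 1) - a n)‖ ≤ (2 ^ n)⁻¹ * (δ n + δ (n + 1) / 2) := by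
      have : a (n + 1) - a n = (y - a n) - (y - a (n + 1)) := by abel
      rw [this, map_sub]
      refine (norm_sub_le _ _).trans ((add_le_add (hMa n) (hMa (n + 1))).trans_eq ?_)
      rw [pow_succ]; field_simp
    have g0 := hγ0 n
    have g1 := hγ0 (n + 1)
    have d0 := hδ0 n
    have d1 := hδ0 (n + 1)
    have f1 : ‖B (b (n + 1) - b n) (a (n + 1))‖ ≤ t * ((2 * γ n + γ (n + 1)) * δ (n + 1)) := by
      refine (hL _ _).trans (mul_le_mul_of_nonneg_left ?_ ht)
      calc _ ≤ ((2 ^ n)⁻¹ * (γ n + γ (n + 1) / 2)) * (2 ^ (n + 1) * δ (n + 1)) := by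
            gcongr; exact ha (n + 1)
        _ = _ := by rw [pow_succ]; field_simp
    have f2 : ‖B (b n) (a (n + 1) - a n)‖ ≤ t * (γ n * (δ n + δ (n + 1) / 2)) := by
      refine (hM _ _).trans (mul_le_mul_of_nonneg_left ?_ ht)
      calc _ ≤ (2 ^ n * γ n) * ((2 ^ n)⁻¹ * (δ n + δ (n + 1) / 2)) := by
            gcongr; exact hb n
        _ = _ := by field_simp
    rw [e]
    refine (norm_add_le _ _).trans ((add_le_add f1 f2).trans ?_)
    rw [← mul_add]
    refine mul_le_mul_of_nonneg_left ?_ ht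
    nlinarith [mul_nonneg g0 d1]
  -- One from the initial term and `3 + 1 + 1` from the increments; with `G` and `D` twice the
  -- interpolation norms this becomes 24.
  have hbound : ∀ N, ‖B (b N) (a N)‖ ≤ 6 * t * (G * D) := by
    intro N
    have e0 : ‖B (b 0) (a 0)‖ ≤ t * (G * D) := by
      have h00 := sum_shift_mul_le hG0 hD0 hγ' hδ' 0 0 1
      simp only [Finset.range_one, Finset.sum_singleton, add_zero] at h00
      refine (hB _ _).trans (mul_le_mul_of_nonneg_left ?_ ht)
      refine le_trans ?_ h00
      have h1 := hb 0
      have h2 := ha 0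
      simp only [pow_zero, one_mul] at h1 h2
      exact mul_le_mul h1 h2 (norm_nonneg _) (hγ0 0)
    have e1 : B (b N) (a N) = B (b 0) (a 0) +
        ∑ n ∈ Finset.range N, (B (b (n + 1)) (a (n + 1)) - B (b n) (a n)) := by
      rw [Finset.sum_range_sub (fun n => B (b n) (a n))]; ring
    have e2 : ∑ n ∈ Finset.range N, ‖B (b (n + 1)) (a (n + 1)) - B (b n) (a n)‖ ≤
        t * (3 * (G * D) + G * D + G * D) := by
      refine (Finset.sum_le_sum fun n _ => hstep n).trans ?_
      rw [← Finset.mul_sum, Finset.sum_add_distrib, Finset.sum_add_distrib, ← Finset.mul_sum]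
      gcongr <;> exact sum_shift_mul_le hG0 hD0 hγ' hδ' _ _ N
    rw [e1]
    refine (norm_add_le _ _).trans ?_
    have := norm_sum_le (Finset.range N) fun n => B (b (n + 1)) (a (n + 1)) - B (b n) (a n)
    linarith
  have hdiff : ∀ N, ‖B x y‖ ≤ 6 * t * (G * D) +
      (t * ((1 / 2) ^ N * (G * ‖y‖)) + t * (γ N ^ 2 + δ N ^ 2)) := by
    intro N
    have e : B x y = B (b N) (a N) + (B (x - b N) y + B (b N) (y - a N)) := by
      simp only [map_sub, LinearMap.sub_apply]; ring
    have g : γ N ≤ G := by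
      refine le_of_sq_le_sq ?_ hG0
      have := sum_shift_sq_le hγ' N 1
      simpa using this
    have f1 : ‖B (x - b N) y‖ ≤ t * ((1 / 2) ^ N * (G * ‖y‖)) := by
      refine (hL _ _).trans ?_
      rw [← mul_assoc (_ ^ N)]
      gcongr
      refine (hLb N).trans ?_
      rw [one_div, inv_pow]
      gcongr
    have f2 : ‖B (b N) (y - a N)‖ ≤ t * (γ N ^ 2 + δ N ^ 2) := by
      refine (hM _ _).trans (mul_le_mul_of_nonneg_left ?_ ht)
      have := hγ0 N
      calc _ ≤ (2 ^ N * γ N) * ((2 ^ N)⁻¹ * δ N) := by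
            gcongr
            · exact hb _
            · exact hMa _
        _ = γ N * δ N := by field_simp
        _ ≤ _ := by nlinarith [sq_nonneg (γ N - δ N), sq_nonneg (γ N), sq_nonneg (δ N)]
    rw [e]
    exact (norm_add_le _ _).trans (add_le_add (hbound N) ((norm_add_le _ _).trans
      (add_le_add f1 f2)))
  have hlim : Filter.Tendsto (fun N : ℕ => 6 * t * (G * D) +
      (t * ((1 / 2) ^ N * (G * ‖y‖)) + t * (γ N ^ 2 + δ N ^ 2))) Filter.atTop
      (𝓝 (6 * t * (G * D) + (t * (0 * (G * ‖y‖)) + t * (0 + 0)))) := by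
    refine tendsto_const_nhds.add (Filter.Tendsto.add ?_ ?_)
    · exact ((tendsto_pow_atTop_nhds_zero_of_lt_one (by norm_num) (by norm_num)).mul_const
        _).const_mul t
    · exact (hγ'.summable.tendsto_atTop_zero.add hδ'.summable.tendsto_atTop_zero).const_mul t
  have := ge_of_tendsto' hlim hdiff
  rw [hG, hD] at this
  linarith

/-- A form as in `norm_bilinear_le_interp` extends to the interpolation spaces. -/
theorem exists_interp_pairing (B : A →ₗ[ℂ] A →ₗ[ℂ] ℂ) (L : A →L[ℂ] X) (M : A →L[ℂ] Y) {C : ℝ}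
    (hC : 0 ≤ C) (h : ∀ x y, ‖B x y‖ ≤ C * (‖toInterp L x‖ * ‖toInterp M y‖)) :
    ∃ β : InterpSpace L →L[ℂ] StrongDual ℂ (InterpSpace M), ‖β‖ ≤ C ∧
      ∀ x y, β (toInterp L x) (toInterp M y) = B x y := by
  have h' : ∀ x y, ‖B x y‖ ≤ (C * ‖toInterp L x‖) * ‖toInterp M y‖ := fun x y => by
    rw [mul_assoc]; exact h x y
  have hd := denseRange_toInterp M
  have ek : ∀ x y, (B x).extendOfNorm (toInterp M) (toInterp M y) = B x y := fun x y =>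
    LinearMap.extendOfNorm_eq hd ⟨_, h' x⟩ y
  let k : A →ₗ[ℂ] StrongDual ℂ (InterpSpace M) :=
    { toFun := fun x => (B x).extendOfNorm (toInterp M)
      map_add' := fun x x' => by
        refine ContinuousLinearMap.ext fun v => congrFun (hd.equalizer
          (ContinuousLinearMap.continuous _) (ContinuousLinearMap.continuous _) ?_) v
        funext y
        change (B (x + x')).extendOfNorm (toInterp M) (toInterp M y) =
          (B x).extendOfNorm (toInterp M) (toInterp M y) +
          (B x').extendOfNorm (toInterp M) (toInterp M y)
        rw [ek, ek, ek, map_add, LinearMap.add_apply]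
      map_smul' := fun c x => by
        refine ContinuousLinearMap.ext fun v => congrFun (hd.equalizer
          (ContinuousLinearMap.continuous _) (ContinuousLinearMap.continuous _) ?_) v
        funext y
        change (B (c • x)).extendOfNorm (toInterp M) (toInterp M y) =
          c • (B x).extendOfNorm (toInterp M) (toInterp M y)
        rw [ek, ek, map_smul, LinearMap.smul_apply] }
  have hk : ∀ x, ‖k x‖ ≤ C * ‖toInterp L x‖ := fun x =>
    LinearMap.opNorm_extendOfNorm_le hd (by positivity) (h' x)
  refine ⟨k.extendOfNorm (toInterp L),
    LinearMap.opNorm_extendOfNorm_le (denseRange_toInterp L) hC hk, fun x y => ?_⟩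
  rw [LinearMap.extendOfNorm_eq (denseRange_toInterp L) ⟨C, hk⟩]
  exact LinearMap.extendOfNorm_eq hd ⟨_, h' x⟩ y

theorem exists_interp_action [CompleteSpace A] [CompleteSpace X] (L : A →L[ℂ] X)
    (R : A →ₗ[ℂ] A →ₗ[ℂ] A)
    (R' : A → X →ₗ[ℂ] X) (hR : ∀ a b, ‖R a b‖ ≤ ‖a‖ * ‖b‖) (hR' : ∀ a x, ‖R' a x‖ ≤ ‖a‖ * ‖x‖)
    (h : ∀ a b, L (R a b) = R' a (L b)) :
    ∃ U : A →ₗ[ℂ] InterpSpace L →L[ℂ] InterpSpace L,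
      (∀ a b, U a (toInterp L b) = toInterp L (R a b)) ∧ ∀ a u, ‖U a u‖ ≤ ‖a‖ * ‖u‖ := by
  have hd := denseRange_toInterp L
  have hb : ∀ a b, ‖((toInterp L) ∘ₗ R a) b‖ ≤ ‖a‖ * ‖toInterp L b‖ := fun a b =>
    norm_toInterp_map_le (norm_nonneg a) (hR a) (hR' a) (h a) b
  have ek : ∀ a b, ((toInterp L) ∘ₗ R a).extendOfNorm (toInterp L) (toInterp L b) =
      toInterp L (R a b) := fun a b => LinearMap.extendOfNorm_eq hd ⟨_, hb a⟩ b
  refine ⟨{ toFun := fun a => ((toInterp L) ∘ₗ R a).extendOfNorm (toInterp L)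
            map_add' := fun a a' => ?_
            map_smul' := fun c a => ?_ }, fun a b => ?_, fun a u => ?_⟩
  · refine ContinuousLinearMap.ext fun v => congrFun (hd.equalizer
      (ContinuousLinearMap.continuous _) (ContinuousLinearMap.continuous _) ?_) v
    funext b
    change ((toInterp L) ∘ₗ R (a + a')).extendOfNorm (toInterp L) (toInterp L b) =
      ((toInterp L) ∘ₗ R a).extendOfNorm (toInterp L) (toInterp L b) +
      ((toInterp L) ∘ₗ R a').extendOfNorm (toInterp L) (toInterp L b)
    rw [ek, ek, ek, map_add, LinearMap.add_apply, map_add]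
  · refine ContinuousLinearMap.ext fun v => congrFun (hd.equalizer
      (ContinuousLinearMap.continuous _) (ContinuousLinearMap.continuous _) ?_) v
    funext b
    change ((toInterp L) ∘ₗ R (c • a)).extendOfNorm (toInterp L) (toInterp L b) =
      c • ((toInterp L) ∘ₗ R a).extendOfNorm (toInterp L) (toInterp L b)
    rw [ek, ek, map_smul, LinearMap.smul_apply, map_smul]
  · exact ek a b
  · exact LinearMap.norm_extendOfNorm_apply_le hd _ (hb a) u

end Bilinear

/-! ### Reflexivity of duals and products. -/

section Reflexive

variable {E F : Type*} [NormedAddCommGroup E] [NormedSpace ℂ E]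
  [NormedAddCommGroup F] [NormedSpace ℂ F]

theorem IsReflexiveSpace.dual (h : IsReflexiveSpace E) : IsReflexiveSpace (StrongDual ℂ E) := by
  intro Φ
  refine ⟨Φ.comp (NormedSpace.inclusionInDoubleDual ℂ E), ?_⟩
  ext ψ
  obtain ⟨v, rfl⟩ := h ψ
  simp

theorem IsReflexiveSpace.prod (hE : IsReflexiveSpace E) (hF : IsReflexiveSpace F) :
    IsReflexiveSpace (E × F) := by
  intro Φ
  obtain ⟨x, hx⟩ := hE (Φ.comp ((ContinuousLinearMap.compL ℂ (E × F) E ℂ).flip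
    (ContinuousLinearMap.fst ℂ E F)))
  obtain ⟨y, hy⟩ := hF (Φ.comp ((ContinuousLinearMap.compL ℂ (E × F) F ℂ).flip
    (ContinuousLinearMap.snd ℂ E F)))
  refine ⟨(x, y), ?_⟩
  ext f
  have h1 := DFunLike.congr_fun hx (f.comp (ContinuousLinearMap.inl ℂ E F))
  have h2 := DFunLike.congr_fun hy (f.comp (ContinuousLinearMap.inr ℂ E F))
  have h3 : f = (f.comp (ContinuousLinearMap.inl ℂ E F)).comp (ContinuousLinearMap.fst ℂ E F) +
      (f.comp (ContinuousLinearMap.inr ℂ E F)).comp (ContinuousLinearMap.snd ℂ E F) := by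
    refine ContinuousLinearMap.ext fun z => ?_
    simp [← map_add]
  have h4 : Φ f = f (x, 0) + f (0, y) := by
    conv_lhs => rw [h3, map_add]
    exact (congrArg₂ (· + ·) h1 h2).symm
  rw [NormedSpace.dual_def, h4, ← map_add]
  simp

end Reflexive

/-! ### Representable maps lie in `σWC`; weak-star continuity of extended actions. -/

section Module

variable {A E : Type*} [NormedRing A] [NormedAlgebra ℂ A] [NormedAddCommGroup E] [NormedSpace ℂ E]

/-- A contractive linear action, as a bounded bilinear map. -/
noncomputable def actionL (U : A →ₗ[ℂ] E →L[ℂ] E) (hU : ∀ a x, ‖U a x‖ ≤ ‖a‖ * ‖x‖) :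
    A →L[ℂ] E →L[ℂ] E :=
  U.mkContinuous 1 fun a => by
    rw [one_mul]; exact ContinuousLinearMap.opNorm_le_bound _ (norm_nonneg a) (hU a)

variable {P : Type*} [NormedAddCommGroup P] [NormedSpace ℂ P]

theorem mem_sigmaWC_of_representation (D : DualBanachAlgebra A P) {T : A →L[ℂ] StrongDual ℂ A}
    (M : BanachLeftModule A E) (hE : IsReflexiveSpace E) (hM : M.IsNormal D) (x : E)
    (μ : StrongDual ℂ E) (S : E →L[ℂ] E)
    (hT : ∀ a b : A, T b a = M.dualRact μ a (S (M.lact b x))) :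
    T ∈ sigmaWC D (operatorBimodule A) := by
  let Λ := actionL M.lact M.norm_lact_le
  have hT' : ∀ a b : A, T b a = μ (M.lact a (S (M.lact b x))) := hT
  constructor
  · let φ : E →L[ℂ] A →L[ℂ] StrongDual ℂ A :=
      (ContinuousLinearMap.compL ℂ A E (StrongDual ℂ A)
        (((ContinuousLinearMap.compL ℂ A E ℂ μ).comp Λ.flip).comp S)).comp Λ.flip
    have hφ : ∀ c, (operatorBimodule A).lact c T = φ (M.lact c x) := fun c => by
      ext b a
      rw [operatorBimodule_lact_apply, hT', M.lact_mul]
      rfl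
    rw [continuous_weakTopology_iff]
    intro f
    simp only [hφ]
    exact (continuous_weakTopology_iff _ _).mp (hM x) (f.comp φ)
  · let ψ : StrongDual ℂ E →L[ℂ] A →L[ℂ] StrongDual ℂ A :=
      ((ContinuousLinearMap.compL ℂ A (A →L[ℂ] E) (StrongDual ℂ A)).flip
        ((Λ.flip.comp S).comp (Λ.flip x))).comp (ContinuousLinearMap.compL ℂ A E ℂ)
    have hψ : ∀ c, (operatorBimodule A).ract c T = ψ (M.dualRact μ c) := fun c => by
      ext b a
      rw [operatorBimodule_ract_apply, hT', M.lact_mul]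
      rfl
    rw [continuous_weakTopology_iff]
    intro f
    -- Reflexivity turns a functional on `E'` into a point of `E`, so that normality at `y` applies.
    obtain ⟨y, hy⟩ := hE (f.comp ψ)
    have hy' : ∀ c, f (ψ (M.dualRact μ c)) = μ (M.lact c y) := fun c =>
      (DFunLike.congr_fun hy (M.dualRact μ c)).symm
    simp only [hψ, hy']
    exact (continuous_weakTopology_iff _ _).mp (hM y) μ

/-- Normality need only be tested on a dense set of vectors, since the predual is norm closed in
`A'`. -/
theorem exists_predual_action [CompleteSpace P] (D : A ≃ₗᵢ[ℂ] StrongDual ℂ P)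
    (U : A →ₗ[ℂ] E →L[ℂ] E) (hU : ∀ a x, ‖U a x‖ ≤ ‖a‖ * ‖x‖) {J : A → E} (hJ : DenseRange J)
    (ν : StrongDual ℂ E) (h : ∀ b, ∃ p : P, ∀ a, ν (U a (J b)) = D a p) (u : E) :
    ∃ p : P, ∀ a, ν (U a u) = D a p := by
  let k : E →L[ℂ] StrongDual ℂ A :=
    (ContinuousLinearMap.compL ℂ A E ℂ ν).comp (actionL U hU).flip
  refine (mem_range_predualEmbedding_iff D (k u)).mp ?_
  refine hJ.induction_on (p := fun u => k u ∈ Set.range (predualEmbedding D)) u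
    ((isClosed_range_predualEmbedding D).preimage k.continuous) fun b => ?_
  exact (mem_range_predualEmbedding_iff D _).mpr (h b)

end Module

/-! ### Construction of the representing module. -/

section Construction

variable {A P : Type*} [NormedRing A] [NormedAlgebra ℂ A] [NormedAddCommGroup P] [NormedSpace ℂ P]

theorem DualBanachAlgebra.exists_predual_mul_right (D : DualBanachAlgebra A P) (b : A) (p : P) :
    ∃ q : P, ∀ a, D.toDual (a * b) p = D.toDual a q := by
  let g : A →ₗ[ℂ] ℂ := (predualEmbedding D.toDual p).toLinearMap ∘ₗ LinearMap.mulRight ℂ b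
  exact exists_predual_of_continuous D.toDual g
    (@Continuous.comp A A ℂ (weakStarTopology D.toDual) (weakStarTopology D.toDual) _
      (fun a => a * b) (fun c => D.toDual c p)
      (continuous_weakStar_apply D.toDual p) (D.continuous_mul_right b))

theorem DualBanachAlgebra.exists_predual_mul_left (D : DualBanachAlgebra A P) (b : A) (p : P) :
    ∃ q : P, ∀ a, D.toDual (b * a) p = D.toDual a q := by
  let g : A →ₗ[ℂ] ℂ := (predualEmbedding D.toDual p).toLinearMap ∘ₗ LinearMap.mulLeft ℂ b
  exact exists_predual_of_continuous D.toDual g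
    (@Continuous.comp A A ℂ (weakStarTopology D.toDual) (weakStarTopology D.toDual) _
      (fun a => b * a) (fun c => D.toDual c p)
      (continuous_weakStar_apply D.toDual p) (D.continuous_mul_left b))

/-- The direct sum of a left module and the dual of a right module. -/
noncomputable def BanachLeftModule.prodDual {E F : Type*} [NormedAddCommGroup E] [NormedSpace ℂ E]
    [NormedAddCommGroup F] [NormedSpace ℂ F] (U : A →ₗ[ℂ] E →L[ℂ] E) (V : A →ₗ[ℂ] F →L[ℂ] F)
    (hU : ∀ a x, ‖U a x‖ ≤ ‖a‖ * ‖x‖) (hV : ∀ a x, ‖V a x‖ ≤ ‖a‖ * ‖x‖)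
    (hU' : ∀ a b x, U (a * b) x = U a (U b x)) (hV' : ∀ a b x, V (a * b) x = V b (V a x)) :
    BanachLeftModule A (E × StrongDual ℂ F) where
  lact :=
    { toFun := fun a => (U a).prodMap ((ContinuousLinearMap.compL ℂ F F ℂ).flip (V a))
      map_add' := fun a b => by ext <;> simp
      map_smul' := fun c a => by ext <;> simp }
  lact_mul := fun a b x => by
    refine Prod.ext (hU' a b x.1) ?_
    ext v
    exact congrArg x.2 (hV' a b v)
  norm_lact_le := fun a x => by
    refine max_le ((hU a x.1).trans (by gcongr; exact le_max_left _ _)) ?_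
    have : ‖x.2.comp (V a)‖ ≤ ‖x.2‖ * ‖a‖ := (ContinuousLinearMap.opNorm_comp_le _ _).trans (by
      gcongr; exact ContinuousLinearMap.opNorm_le_bound _ (norm_nonneg a) (hV a))
    refine this.trans ?_
    rw [mul_comm]
    gcongr
    exact le_max_right _ _

theorem exists_representation_of_interp {A : Type u} {P : Type v} [NormedRing A] [NormedAlgebra ℂ A]
    [NormOneClass A] [CompleteSpace A] [NormedAddCommGroup P] [NormedSpace ℂ P] [CompleteSpace P]
    {X Y : Type u} [NormedAddCommGroup X] [NormedSpace ℂ X] [CompleteSpace X]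
    [NormedAddCommGroup Y] [NormedSpace ℂ Y] [CompleteSpace Y]
    (D : DualBanachAlgebra A P) (B : A →ₗ[ℂ] A →ₗ[ℂ] ℂ) {L : A →L[ℂ] X} {M : A →L[ℂ] Y}
    (hLadj : IsAdjointable D.toDual L) (hMadj : IsAdjointable D.toDual M)
    (l : A → X →ₗ[ℂ] X) (hl : ∀ a x, ‖l a x‖ ≤ ‖a‖ * ‖x‖) (hLl : ∀ a b, L (a * b) = l a (L b))
    (r : A → Y →ₗ[ℂ] Y) (hr : ∀ a y, ‖r a y‖ ≤ ‖a‖ * ‖y‖) (hMr : ∀ a b, M (b * a) = r a (M b))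
    {t : ℝ} (ht : 0 ≤ t) (hB : ∀ x y, ‖B x y‖ ≤ t * (‖x‖ * ‖y‖))
    (hBL : ∀ x y, ‖B x y‖ ≤ t * (‖L x‖ * ‖y‖)) (hBM : ∀ x y, ‖B x y‖ ≤ t * (‖x‖ * ‖M y‖)) :
    ∃ (E : Type u) (_ : NormedAddCommGroup E) (_ : NormedSpace ℂ E)
      (M : BanachLeftModule A E) (x : E) (μ : StrongDual ℂ E) (S : E →L[ℂ] E),
      CompleteSpace E ∧ IsReflexiveSpace E ∧ M.IsNormal D ∧
      (∀ a b : A, B b a = M.dualRact μ a (S (M.lact b x))) ∧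
      ‖x‖ * ‖μ‖ * ‖S‖ ≤ 96 * t := by
  obtain ⟨U, hUJ, hU⟩ := exists_interp_action L (LinearMap.mul ℂ A) l
    (fun a b => norm_mul_le a b) hl hLl
  obtain ⟨V, hVJ, hV⟩ := exists_interp_action M (LinearMap.mul ℂ A).flip r
    (fun a b => (norm_mul_le b a).trans_eq (mul_comm _ _)) hr hMr
  obtain ⟨β, hβ, hβB⟩ := exists_interp_pairing B L M (C := 24 * t) (by positivity)
    (norm_bilinear_le_interp B L M ht hB hBL hBM)
  have hU' : ∀ a b u, U (a * b) u = U a (U b u) := fun a b =>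
    congrFun ((denseRange_toInterp L).equalizer (g := U (a * b)) (h := (U a).comp (U b))
      (ContinuousLinearMap.continuous _) (ContinuousLinearMap.continuous _)
      (by funext c; simp [hUJ, mul_assoc]))
  have hV' : ∀ a b u, V (a * b) u = V b (V a u) := fun a b =>
    congrFun ((denseRange_toInterp M).equalizer (g := V (a * b)) (h := (V b).comp (V a))
      (ContinuousLinearMap.continuous _) (ContinuousLinearMap.continuous _)
      (by funext c; simp [hVJ, mul_assoc]))
  -- `β` maps between two different modules; on their direct sum it becomes an endomorphism.
  let N : BanachLeftModule A (InterpSpace L × StrongDual ℂ (InterpSpace M)) :=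
    BanachLeftModule.prodDual U V hU hV hU' hV'
  let ev : StrongDual ℂ (StrongDual ℂ (InterpSpace M)) :=
    NormedSpace.inclusionInDoubleDual ℂ _ (toInterp M 1)
  have hMrefl : IsReflexiveSpace (InterpSpace M) := isReflexiveSpace_interpSpace hMadj
  refine ⟨InterpSpace L × StrongDual ℂ (InterpSpace M), inferInstance, inferInstance, N,
    (toInterp L 1, 0), ev.comp (ContinuousLinearMap.snd ℂ _ _),
    ((ContinuousLinearMap.inr ℂ _ _).comp β).comp (ContinuousLinearMap.fst ℂ _ _),
    inferInstance, (isReflexiveSpace_interpSpace hLadj).prod hMrefl.dual, ?_, ?_, ?_⟩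
  · rintro ⟨u, φ⟩
    rw [continuous_weakTopology_iff]
    intro f
    -- On the dual summand `f` is evaluation at some `v`, which reduces normality there to the right
    -- action on `v`.
    obtain ⟨v, hv⟩ := hMrefl (f.comp (ContinuousLinearMap.inr ℂ _ _))
    obtain ⟨p, hp⟩ := exists_predual_action D.toDual U hU (denseRange_toInterp L)
      (f.comp (ContinuousLinearMap.inl ℂ _ _)) (fun b => by
        obtain ⟨q, hq⟩ := exists_predual_toInterp hLadj (f.comp (ContinuousLinearMap.inl ℂ _ _))
        obtain ⟨r, hr⟩ := D.exists_predual_mul_right b q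
        exact ⟨r, fun a => by rw [hUJ, hq, ← hr]; rfl⟩) u
    obtain ⟨p', hp'⟩ := exists_predual_action D.toDual V hV (denseRange_toInterp M) φ (fun b => by
        obtain ⟨q, hq⟩ := exists_predual_toInterp hMadj φ
        obtain ⟨r, hr⟩ := D.exists_predual_mul_left b q
        exact ⟨r, fun a => by rw [hVJ, hq, ← hr]; rfl⟩) v
    have e : ∀ a, f (N.lact a (u, φ)) = D.toDual a (p + p') := fun a => by
      have e1 : N.lact a (u, φ) = (U a u, 0) + (0, φ.comp (V a)) := by
        rw [Prod.mk_add_mk, add_zero, zero_add]; rfl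
      rw [e1, map_add, map_add, ← hp, ← hp']
      exact congrArg₂ (· + ·) rfl (DFunLike.congr_fun hv (φ.comp (V a))).symm
    simp only [e]
    exact continuous_weakStar_apply D.toDual (p + p')
  · intro a b
    change B b a = β (U b (toInterp L 1)) (V a (toInterp M 1))
    rw [hUJ, hVJ, hβB]
    simp
  · have h1 : ‖((toInterp L 1, 0) : InterpSpace L × StrongDual ℂ (InterpSpace M))‖ ≤ 2 := by
      have := norm_toInterp_le L 1
      rw [norm_one, mul_one] at this
      simpa [Prod.norm_def] using this
    have h2 : ‖ev.comp (ContinuousLinearMap.snd ℂ (InterpSpace L) _)‖ ≤ 2 := by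
      have := norm_toInterp_le M 1
      rw [norm_one, mul_one] at this
      refine ContinuousLinearMap.opNorm_le_bound _ zero_le_two fun z => ?_
      refine (z.2.le_opNorm (toInterp M 1)).trans ?_
      rw [mul_comm]
      gcongr
      exact le_max_right _ _
    have h3 : ‖((ContinuousLinearMap.inr ℂ (InterpSpace L) _).comp β).comp
        (ContinuousLinearMap.fst ℂ (InterpSpace L) (StrongDual ℂ (InterpSpace M)))‖ ≤ 24 * t := by
      refine ContinuousLinearMap.opNorm_le_bound _ (by positivity) fun z => ?_
      have h4 : ‖((0 : InterpSpace L), β z.1)‖ = ‖β z.1‖ := by simp [Prod.norm_def]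
      refine h4.le.trans (β.le_of_opNorm_le_of_le hβ (le_max_left _ _))
    calc _ ≤ 2 * 2 * (24 * t) := by gcongr
      _ = 96 * t := by ring

theorem IsAdjointable.smul {A X P : Type*} [NormedAddCommGroup A] [NormedSpace ℂ A]
    [NormedAddCommGroup X] [NormedSpace ℂ X] [NormedAddCommGroup P] [NormedSpace ℂ P]
    {D : A ≃ₗᵢ[ℂ] StrongDual ℂ P} {L : A →L[ℂ] X} (hL : IsAdjointable D L) (c : ℂ) :
    IsAdjointable D (c • L) := fun f => by
  obtain ⟨p, hp⟩ := hL (c • f)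
  exact ⟨p, fun a => Eq.trans (by simp) (hp a)⟩

theorem norm_le_of_smul_inv {X : Type*} [NormedAddCommGroup X] [NormedSpace ℂ X] {t : ℝ} {z : ℂ}
    {x : X} {r : ℝ} (ht : t = 0 → z = 0) (h0 : 0 ≤ t) (hz : ‖z‖ ≤ ‖x‖ * r) :
    ‖z‖ ≤ t * (‖(t : ℂ)⁻¹ • x‖ * r) := by
  by_cases h : t = 0
  · simp [h, ht h]
  · rw [norm_smul, norm_inv, Complex.norm_real, Real.norm_of_nonneg h0, ← mul_assoc, ← mul_assoc,
      mul_inv_cancel₀ h, one_mul]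
    exact hz

theorem exists_representation {A : Type u} {P : Type v} [NormedRing A] [NormedAlgebra ℂ A]
    [NormOneClass A] [CompleteSpace A] [NormedAddCommGroup P] [NormedSpace ℂ P] [CompleteSpace P]
    (D : DualBanachAlgebra A P) {T : A →L[ℂ] StrongDual ℂ A}
    (hT : T ∈ sigmaWC D (operatorBimodule A)) :
    ∃ (E : Type u) (_ : NormedAddCommGroup E) (_ : NormedSpace ℂ E)
      (M : BanachLeftModule A E) (x : E) (μ : StrongDual ℂ E) (S : E →L[ℂ] E),
      CompleteSpace E ∧ IsReflexiveSpace E ∧ M.IsNormal D ∧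
      (∀ a b : A, T b a = M.dualRact μ a (S (M.lact b x))) ∧
      ‖x‖ * ‖μ‖ * ‖S‖ ≤ 96 * ‖T‖ := by
  let O := operatorBimodule A
  let L := (actionL O.lact O.norm_lact_le).flip T
  let M := (actionL O.ract O.norm_ract_le).flip T
  have hL : IsAdjointable D.toDual L := (isAdjointable_iff _ _).mpr hT.1
  have hM : IsAdjointable D.toDual M := (isAdjointable_iff _ _).mpr hT.2
  -- The unit recovers `T` from each of its orbits; this gives the two endpoint estimates.
  have hLT : ∀ x y, T x y = L x 1 y := fun x y => by
    have : L x 1 y = T (1 * x) y := rfl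
    rw [this, one_mul]
  have hMT : ∀ x y, T x y = M y x 1 := fun x y => by
    have : M y x 1 = T x (y * 1) := rfl
    rw [this, mul_one]
  have hT0 : ∀ x y, ‖T‖ = 0 → T x y = 0 := fun x y h => by
    have := T.le_opNorm₂ x y
    rw [h, zero_mul, zero_mul] at this
    exact norm_le_zero_iff.mp this
  -- Dividing both orbit maps by `‖T‖` gives all three bounds on the form the same factor `‖T‖`, so
  -- the final estimate is linear in `‖T‖`; if `‖T‖ = 0` the form vanishes.
  refine exists_representation_of_interp D (ContinuousLinearMap.toLinearMap₁₂ T)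
    (hL.smul (‖T‖ : ℂ)⁻¹) (hM.smul (‖T‖ : ℂ)⁻¹)
    (fun a => (O.lact a).toLinearMap) O.norm_lact_le (fun a b => ?_)
    (fun a => (O.ract a).toLinearMap) O.norm_ract_le (fun a b => ?_) (norm_nonneg T)
    (fun x y => ?_) (fun x y => ?_) (fun x y => ?_)
  · have h : L (a * b) = O.lact a (L b) := O.lact_mul a b T
    simp [h]
  · have h : M (b * a) = O.ract a (M b) := O.ract_mul b a T
    simp [h]
  · rw [← mul_assoc]; exact T.le_opNorm₂ x y
  · refine norm_le_of_smul_inv (x := L x) (z := T x y) (hT0 x y) (norm_nonneg T) ?_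
    have := (L x).le_opNorm₂ 1 y
    rw [norm_one, mul_one, ← hLT] at this
    exact this
  · rw [mul_comm ‖x‖]
    refine norm_le_of_smul_inv (x := M y) (z := T x y) (hT0 x y) (norm_nonneg T) ?_
    have := (M y).le_opNorm₂ x 1
    rw [norm_one, mul_one, ← hMT] at this
    exact this

end Construction

theorem mainTheorem9 :
    ∃ K : ℝ, 0 < K ∧
      ∀ (A : Type u) [NormedRing A] [NormedAlgebra ℂ A] [NormOneClass A] [CompleteSpace A]
        (P : Type v) [NormedAddCommGroup P] [NormedSpace ℂ P] [CompleteSpace P]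
        (D : DualBanachAlgebra A P) (T : A →L[ℂ] StrongDual ℂ A),
        (T ∈ sigmaWC D (operatorBimodule A) ↔
          ∃ (E : Type u) (_ : NormedAddCommGroup E) (_ : NormedSpace ℂ E)
            (M : BanachLeftModule A E) (x : E) (μ : StrongDual ℂ E) (S : E →L[ℂ] E),
            CompleteSpace E ∧ IsReflexiveSpace E ∧ M.IsNormal D ∧
            ∀ a b : A, T b a = M.dualRact μ a (S (M.lact b x))) ∧
        (T ∈ sigmaWC D (operatorBimodule A) →
          ∃ (E : Type u) (_ : NormedAddCommGroup E) (_ : NormedSpace ℂ E)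
            (M : BanachLeftModule A E) (x : E) (μ : StrongDual ℂ E) (S : E →L[ℂ] E),
            CompleteSpace E ∧ IsReflexiveSpace E ∧ M.IsNormal D ∧
            (∀ a b : A, T b a = M.dualRact μ a (S (M.lact b x))) ∧
            ‖x‖ * ‖μ‖ * ‖S‖ ≤ K * ‖T‖) := by
  refine ⟨96, by norm_num, fun A _ _ _ _ P _ _ _ D T => ⟨⟨fun hT => ?_, ?_⟩, fun hT =>
    exists_representation D hT⟩⟩
  · obtain ⟨E, i1, i2, M, x, μ, S, h1, h2, h3, h4, -⟩ := exists_representation D hT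
    exact ⟨E, i1, i2, M, x, μ, S, h1, h2, h3, h4⟩
  · rintro ⟨E, i1, i2, M, x, μ, S, -, h2, h3, h4⟩
    exact mem_sigmaWC_of_representation D M h2 h3 x μ S h4
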